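/- Let $0<\epsilon<1$ and $r>0$ be constants. For $n\ge 2$ with $\frac{r}{n\ln n}\le 1$, let $\mathbb{G}=\mathbb{G}(n,p_2,p_3)$ be the random hypergraph on $n$ vertices in which, independently, each pair of vertices is a 2-edge with probability $p_2=\frac{1-\epsilon}{n}$ and each triple of vertices is a 3-edge with probability $p_3=\frac{r}{n\ln n}$. For a vertex $v_0$, let the propagation component $C_{v_0}$ be the set of vertices marked by the following process: initially only $v_0$ is marked, and whenever all vertices of some edge except one have been marked, the remaining vertex of that edge is marked too. Put $\lambda(x)=1-\epsilon+rx$, $\lambda_1(x)=1-\epsilon+\frac r2x$, $K_0=\max\{1,\lambda_1^{-1}(10)\}$ and $$I_{\epsilon,r}=\int_0^{\epsilon/r}\bigl[1-\lambda(\omega)+\ln\lambda(\omega)\bigr]\,d\omega .$$ Then for any given vertex $v_0$, $$\mathbf{Pr}\bigl[|C_{v_0}|\ge K_0\ln n\bigr]\le n^{I_{\epsilon,r}+o(1)}\qquad(n\to\infty),$$ that is, there is a sequence $\delta_n\to 0$, depending only on $\epsilon$ and $r$, such that for all such $n$ and every vertex $v_0$ the probability on the left is at most $n^{I_{\epsilon,r}+\delta_n}$.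 -/

import Mathlib

namespace PropConn

/-- A hypergraph on the vertex set `V` with 2-edges and 3-edges: the pair of the set of its
2-edges and the set of its 3-edges. -/
abbrev Hypergraph23 (V : Type*) : Type _ :=
  Set {e : Finset V // e.card = 2} × Set {e : Finset V // e.card = 3}

/-- `e` is an edge (a 2-edge or a 3-edge) of `H`. -/
def Hypergraph23.IsEdge {V : Type*} (H : Hypergraph23 V) (e : Finset V) : Prop :=
  (∃ h : e.card = 2, ⟨e, h⟩ ∈ H.1) ∨ (∃ h : e.card = 3, ⟨e, h⟩ ∈ H.2)

/-- The vertices that get marked by the propagation process started from the single marked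
vertex `v₀`: whenever all vertices of an edge except one vertex `u` have been marked, the
vertex `u` is marked as well. -/
inductive Marked {V : Type*} (H : Hypergraph23 V) (v₀ : V) : V → Prop
  | start : Marked H v₀ v₀
  | step (e : Finset V) (u : V) (he : H.IsEdge e) (hu : u ∈ e)
      (hmarked : ∀ w ∈ e, w ≠ u → Marked H v₀ w) : Marked H v₀ u

/-- The propagation component `C_{v₀}` generated by `v₀`. -/
def component {V : Type*} (H : Hypergraph23 V) (v₀ : V) : Set V := {u | Marked H v₀ u}

/-- The random hypergraph `G(n, p₂, p₃)` on the vertex set `Fin n`: every 2-element set is a 2-edge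
with probability `p₂`, every 3-element set is a 3-edge with probability `p₃`, all independently. -/
noncomputable def randomHypergraph (n : ℕ) (p₂ p₃ : unitInterval) :
    MeasureTheory.Measure (Hypergraph23 (Fin n)) :=
  (ProbabilityTheory.setBernoulli Set.univ p₂).prod (ProbabilityTheory.setBernoulli Set.univ p₃)

/-- `λ(x) = 1 - ε + r x`. -/
noncomputable def lam (ε r x : ℝ) : ℝ := 1 - ε + r * x

/-- `λ₁(x) = 1 - ε + (r / 2) x`. -/
noncomputable def lam₁ (ε r x : ℝ) : ℝ := 1 - ε + r / 2 * x

/-- `λ₁⁻¹(10)`, see `lam₁_eq_ten_iff`. -/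
noncomputable def lam₁InvTen (ε r : ℝ) : ℝ := 2 * (9 + ε) / r

theorem lam₁_eq_ten_iff {ε r x : ℝ} (hr : 0 < r) : lam₁ ε r x = 10 ↔ x = lam₁InvTen ε r := by
  unfold lam₁ lam₁InvTen
  rw [eq_div_iff hr.ne']
  constructor <;> intro h <;> linarith

/-- `K₀ = max {1, λ₁⁻¹(10)}`. -/
noncomputable def K₀ (ε r : ℝ) : ℝ := max 1 (lam₁InvTen ε r)

/-- `I_{ε,r} = ∫₀^{ε/r} (1 - λ(ω) + ln λ(ω)) dω`. -/
noncomputable def rateI (ε r : ℝ) : ℝ :=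
  ∫ x in (0 : ℝ)..(ε / r), (1 - lam ε r x + Real.log (lam ε r x))

end PropConn

namespace PropConn

/-! ### Exploration of the component, one vertex at a time -/

variable {V : Type*}

/-! Process marked vertices one by one, with `P` the processed and `M` the marked ones. Processing
`w` reveals only the edges `e` with `e \ P = {w, u}`, and the later exploration never looks at these
again (`disjoint_process`), so successive steps are independent. With `s` vertices processed, a
given unmarked vertex is newly marked with probability at most `p₂ + s p₃`, so the number `X_s` of
new marks has exponential moments at most those of a Poisson variable of mean `n (p₂ + s p₃) = λ(s /
ln n)`.

A component of more than `m` vertices forces every partial sum of the `X_s - 1`, up to `m` terms, to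
be nonnegative. For nonnegative decreasing tilts `θ s`, summation by parts then gives `∑ θ s (X_s -
1) ≥ 0`, and Markov's inequality yields the bound `exp ∑ (λ (exp (θ s) - 1) - θ s)`;
`measureReal_reachEvent_le_exp` does this by induction. The optimal tilt `-ln λ` turns each summand
into `1 - λ + ln λ`, and the Riemann sum up to `ε / r`, where `λ = 1`, is about `I ln n`. -/

lemma Hypergraph23.IsEdge.card_mem {H : Hypergraph23 V} {e : Finset V} (he : H.IsEdge e) :
    e.card = 2 ∨ e.card = 3 :=
  he.imp (fun h => h.1) (fun h => h.1)

variable [DecidableEq V]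

/-- The closure of `M` under propagation along those edges of `H` that have at least two vertices
outside the set `P`. -/
inductive Reach (H : Hypergraph23 V) (P M : Finset V) : V → Prop
  | base (u : V) (hu : u ∈ M) : Reach H P M u
  | step (e : Finset V) (u : V) (he : H.IsEdge e) (h2 : 2 ≤ (e \ P).card) (hu : u ∈ e)
      (hmarked : ∀ w ∈ e, w ≠ u → Reach H P M w) : Reach H P M u

/-- The event `U` is determined by which of the sets in `S` are edges. -/
def DependsOnEdges (S : Set (Finset V)) (U : Set (Hypergraph23 V)) : Prop :=
  ∀ H H' : Hypergraph23 V, (∀ e ∈ S, (H.IsEdge e ↔ H'.IsEdge e)) → H ∈ U → H' ∈ U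

/-- The event that at least `k` vertices are reached from `M`. -/
def reachEvent (k : ℕ) (P M : Finset V) : Set (Hypergraph23 V) :=
  {H | k ≤ {v | Reach H P M v}.ncard}

open Classical in
/-- The vertices outside `M` which get marked when `w` is processed after the vertices of `P`. -/
noncomputable def newlyMarked [Fintype V] (P M : Finset V) (w : V) (H : Hypergraph23 V) :
    Finset V :=
  {u | u ∉ M ∧ ∃ e : Finset V, H.IsEdge e ∧ e \ P = {w, u}}

lemma mem_newlyMarked [Fintype V] {P M : Finset V} {w u : V} {H : Hypergraph23 V} :
    u ∈ newlyMarked P M w H ↔ u ∉ M ∧ ∃ e : Finset V, H.IsEdge e ∧ e \ P = {w, u} := by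
  simp [newlyMarked]

lemma Marked.reach {H : Hypergraph23 V} {v₀ v : V} (h : Marked H v₀ v) :
    Reach H ∅ {v₀} v := by
  induction h with
  | start => exact .base _ (by simp)
  | step e u he hu _ ih =>
    refine .step e u he ?_ hu ih
    rw [Finset.sdiff_empty]
    rcases he.card_mem with h | h <;> omega

/-- Once everything marked is processed the exploration is dead: an edge with two vertices outside
`P` has one besides `u`, and that one is unmarked. -/
lemma Reach.mem_of_self {H : Hypergraph23 V} {P : Finset V} {v : V} (h : Reach H P P v) :
    v ∈ P := by
  induction h with
  | base u hu => exact hu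
  | step e u he h2 hu _ ih =>
    obtain ⟨a, ha, hau⟩ := Finset.exists_mem_ne (by omega : 1 < (e \ P).card) u
    rw [Finset.mem_sdiff] at ha
    exact absurd (ih a ha.1 hau) ha.2

/-- An edge that loses its second vertex outside the processed set when `w` joins must satisfy `e \
P = {w, u}`, so its effect is already recorded in `newlyMarked`. -/
lemma Reach.process [Fintype V] {H : Hypergraph23 V} {P M : Finset V} {w v : V} (hPM : P ⊆ M)
    (hwM : w ∈ M) (hwP : w ∉ P) (h : Reach H P M v) :
    Reach H (insert w P) (M ∪ newlyMarked P M w H) v := by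
  induction h with
  | base u hu => exact .base _ (Finset.mem_union_left _ hu)
  | step e u he h2 hu _ ih =>
    by_cases h2' : 2 ≤ (e \ insert w P).card
    · exact .step e u he h2' hu ih
    refine .base _ (Finset.mem_union.2 (or_iff_not_imp_left.2 fun huM => ?_))
    refine mem_newlyMarked.2 ⟨huM, e, he, ?_⟩
    have hue : u ∈ e \ P := Finset.mem_sdiff.2 ⟨hu, fun h => huM (hPM h)⟩
    have huw : u ≠ w := fun h => huM (h ▸ hwM)
    have hsd : e \ insert w P = (e \ P).erase w := by
      ext a; simp only [Finset.mem_sdiff, Finset.mem_insert, Finset.mem_erase]; tauto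
    rw [hsd] at h2'
    have hwe : w ∈ e \ P := by
      by_contra hc
      rw [Finset.erase_eq_of_notMem hc] at h2'
      exact h2' h2
    have hc := Finset.card_erase_of_mem hwe
    symm
    refine Finset.eq_of_subset_of_card_le ?_ ?_
    · intro a ha
      rcases Finset.mem_insert.1 ha with rfl | ha
      · exact hwe
      · rwa [Finset.mem_singleton.1 ha]
    · rw [Finset.card_pair huw.symm]; omega

lemma Reach.congr {H H' : Hypergraph23 V} {P M : Finset V} {v : V}
    (hH : ∀ e : Finset V, 2 ≤ (e \ P).card → (H.IsEdge e ↔ H'.IsEdge e)) (h : Reach H P M v) :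
    Reach H' P M v := by
  induction h with
  | base u hu => exact .base _ hu
  | step e u he h2 hu _ ih => exact .step e u ((hH e h2).1 he) h2 hu ih

lemma dependsOnEdges_reachEvent (k : ℕ) (P M : Finset V) :
    DependsOnEdges {e | 2 ≤ (e \ P).card} (reachEvent k P M) := by
  intro H H' hH hk
  have : {v | Reach H P M v} = {v | Reach H' P M v} :=
    Set.ext fun v => ⟨fun h => h.congr hH, fun h => h.congr fun e he => (hH e he).symm⟩
  simpa only [reachEvent, Set.mem_ofPred_eq, this] using hk

lemma reachEvent_self {k : ℕ} {P : Finset V} (hP : P.card < k) : reachEvent k P P = ∅ := by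
  refine Set.eq_empty_of_forall_notMem fun H (hH : k ≤ _) => ?_
  have h : {v | Reach H P P v}.ncard ≤ (P : Set V).ncard :=
    Set.ncard_le_ncard (fun v hv => Reach.mem_of_self hv) P.finite_toSet
  rw [Set.ncard_coe_finset] at h
  omega

lemma disjoint_process (P : Finset V) (w : V) :
    Disjoint {e : Finset V | ∃ u, e \ P = {w, u}} {e | 2 ≤ (e \ insert w P).card} := by
  rw [Set.disjoint_left]
  rintro e ⟨u, hu⟩ h2
  rw [Set.mem_ofPred_eq] at h2
  have : e \ insert w P ⊆ {u} := by
    intro a ha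
    simp only [Finset.mem_sdiff, Finset.mem_insert, not_or] at ha
    have : a ∈ e \ P := Finset.mem_sdiff.2 ⟨ha.1, ha.2.2⟩
    rw [hu] at this
    simpa [ha.2.1] using this
  have := Finset.card_le_card this
  rw [Finset.card_singleton] at this
  omega

variable [Fintype V]

lemma mem_reachEvent_process {k : ℕ} {P M : Finset V} {w : V} {H : Hypergraph23 V} (hPM : P ⊆ M)
    (hwM : w ∈ M) (hwP : w ∉ P) (h : H ∈ reachEvent k P M) :
    H ∈ reachEvent k (insert w P) (M ∪ newlyMarked P M w H) :=
  le_trans h (Set.ncard_le_ncard (fun _ hv => hv.process hPM hwM hwP) (Set.toFinite _))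

lemma mem_reachEvent_of_le_component {k : ℕ} {v₀ : V} {H : Hypergraph23 V}
    (h : k ≤ (component H v₀).ncard) : H ∈ reachEvent k ∅ {v₀} :=
  le_trans h (Set.ncard_le_ncard (fun _ hv => Marked.reach hv) (Set.toFinite _))

lemma newlyMarked_congr {P M : Finset V} {w : V} {H H' : Hypergraph23 V}
    (hH : ∀ e : Finset V, (∃ u, e \ P = {w, u}) → (H.IsEdge e ↔ H'.IsEdge e)) :
    newlyMarked P M w H = newlyMarked P M w H' := by
  ext u
  simp only [mem_newlyMarked]
  refine and_congr_right fun _ => exists_congr fun e => and_congr_left fun he => hH e ⟨u, he⟩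

lemma dependsOnEdges_newlyMarked_eq (P M N : Finset V) (w : V) :
    DependsOnEdges {e | ∃ u, e \ P = {w, u}} (newlyMarked P M w ⁻¹' {N}) := by
  intro H H' hH hN
  simpa only [Set.mem_preimage, newlyMarked_congr hH] using hN

lemma dependsOnEdges_subset_newlyMarked (P M A : Finset V) (w : V) :
    DependsOnEdges {e | ∃ u ∈ A, e \ P = {w, u}} {H | A ⊆ newlyMarked P M w H} := by
  intro H H' hH hA u hu
  obtain ⟨huM, e, he, heP⟩ := mem_newlyMarked.1 (hA hu)
  exact mem_newlyMarked.2 ⟨huM, e, (hH e ⟨u, hu, heP⟩).1 he, heP⟩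

end PropConn
namespace PropConn

open MeasureTheory ProbabilityTheory unitInterval

/-! ### Independence of events on disjoint sets of edges -/

section Independence

variable {ι : Type*}

lemma setBernoulli_superset (p : I) (s : Finset ι) :
    setBernoulli Set.univ p {T : Set ι | ∀ i ∈ s, i ∈ T} = (toNNReal p : ENNReal) ^ s.card := by
  have h : (fun q : ι → Prop => {i | q i}) ⁻¹' {T : Set ι | ∀ i ∈ s, i ∈ T}
      = (s : Set ι).pi fun _ => {True} := by
    ext q; simp [Set.mem_pi]
  rw [setBernoulli_apply', h, Measure.infinitePi_pi _ (fun _ _ => .singleton _)]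
  simp

variable {V : Type*}

/-- The family of those sets of `k`-sets which contain the finset `e`, if `e` is a `k`-set. -/
def layerEvent (k : ℕ) (e : Finset V) : Set (Set {e : Finset V // e.card = k}) :=
  {T | ∀ h : e.card = k, ⟨e, h⟩ ∈ T}

lemma setBernoulli_biInter_layerEvent (p : I) (k : ℕ) (s : Finset (Finset V)) :
    setBernoulli Set.univ p (⋂ e ∈ s, layerEvent k e)
      = ∏ e ∈ s, if e.card = k then (toNNReal p : ENNReal) else 1 := by
  classical
  have h : (⋂ e ∈ s, layerEvent k e)
      = {T : Set {e : Finset V // e.card = k} |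
          ∀ i ∈ s.subtype (fun e : Finset V => e.card = k), i ∈ T} := by
    ext T
    simp only [layerEvent, Set.mem_iInter, Set.mem_ofPred_eq, Finset.mem_subtype, Subtype.forall]
    exact forall_congr' fun e => forall_comm
  rw [h, setBernoulli_superset, Finset.card_subtype, Finset.prod_ite]
  simp

lemma setBernoulli_layerEvent (p : I) (k : ℕ) (e : Finset V) :
    setBernoulli Set.univ p (layerEvent k e)
      = if e.card = k then (toNNReal p : ENNReal) else 1 := by
  simpa using setBernoulli_biInter_layerEvent p k {e}

variable {n : ℕ} (p₂ p₃ : I)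

instance : IsProbabilityMeasure (randomHypergraph n p₂ p₃) := by
  unfold randomHypergraph; infer_instance

/-- The event that `e` is an edge, as far as its cardinality allows. -/
def edgeEvent (e : Finset V) : Set (Hypergraph23 V) := layerEvent 2 e ×ˢ layerEvent 3 e

lemma mem_edgeEvent_of_card {e : Finset V} (he : e.card = 2 ∨ e.card = 3) {H : Hypergraph23 V} :
    H ∈ edgeEvent e ↔ H.IsEdge e := by
  rcases he with h | h <;> simp [edgeEvent, layerEvent, Hypergraph23.IsEdge, h]

lemma iIndepSet_edgeEvent :
    iIndepSet (fun e : Finset (Fin n) => edgeEvent e) (randomHypergraph n p₂ p₃) := by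
  rw [iIndepSet_iff_meas_biInter fun _ => .of_discrete]
  intro s
  have h : (⋂ e ∈ s, layerEvent 2 e ×ˢ layerEvent 3 e) = (⋂ e ∈ s, layerEvent 2 e) ×ˢ (⋂ e ∈ s, layerEvent 3 e) := by
    ext H; simp [forall_and]
  simp only [edgeEvent, h, randomHypergraph, Measure.prod_prod, setBernoulli_biInter_layerEvent,
    setBernoulli_layerEvent, Finset.prod_mul_distrib]

lemma randomHypergraph_real_isEdge_of_card_two {e : Finset (Fin n)} (he : e.card = 2) :
    (randomHypergraph n p₂ p₃).real {H | H.IsEdge e} = p₂ := by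
  have h : {H : Hypergraph23 (Fin n) | H.IsEdge e} = edgeEvent e :=
    Set.ext fun H => (mem_edgeEvent_of_card (.inl he)).symm
  rw [h, measureReal_def, edgeEvent, randomHypergraph, Measure.prod_prod]
  simp [setBernoulli_layerEvent, he]

lemma randomHypergraph_real_isEdge_of_card_three {e : Finset (Fin n)} (he : e.card = 3) :
    (randomHypergraph n p₂ p₃).real {H | H.IsEdge e} = p₃ := by
  have h : {H : Hypergraph23 (Fin n) | H.IsEdge e} = edgeEvent e :=
    Set.ext fun H => (mem_edgeEvent_of_card (.inr he)).symm
  rw [h, measureReal_def, edgeEvent, randomHypergraph, Measure.prod_prod]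
  simp [setBernoulli_layerEvent, he]

/-- An event determined by the edges in `S` is a preimage under the vector of edge indicators over
`S`, and such vectors over disjoint index sets are independent. -/
lemma DependsOnEdges.measureReal_inter {S T : Set (Finset (Fin n))}
    {U W : Set (Hypergraph23 (Fin n))} (hU : DependsOnEdges S U) (hW : DependsOnEdges T W)
    (hST : Disjoint S T) :
    (randomHypergraph n p₂ p₃).real (U ∩ W)
      = (randomHypergraph n p₂ p₃).real U * (randomHypergraph n p₂ p₃).real W := by
  classical
  set X : Finset (Fin n) → Hypergraph23 (Fin n) → ℕ :=
    fun e => (edgeEvent e).indicator fun _ => 1 with hX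
  have key : ∀ (S : Set (Finset (Fin n))) (U : Set (Hypergraph23 (Fin n))), DependsOnEdges S U →
      (fun H (e : S.toFinset) => X e H) ⁻¹' ((fun H (e : S.toFinset) => X e H) '' U) = U := by
    intro S U hU
    refine Set.Subset.antisymm ?_ (Set.subset_preimage_image _ _)
    rintro H ⟨H', hH', hHH'⟩
    refine hU H' H (fun e he => ?_) hH'
    by_cases hc : e.card = 2 ∨ e.card = 3
    · have h1 : X e H' = X e H := congrFun hHH' ⟨e, Set.mem_toFinset.2 he⟩
      rw [← mem_edgeEvent_of_card hc, ← mem_edgeEvent_of_card hc]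
      simp only [hX, Set.indicator_apply] at h1
      split_ifs at h1 <;> tauto
    · exact ⟨fun h => absurd h.card_mem hc, fun h => absurd h.card_mem hc⟩
  have hind : iIndepFun X (randomHypergraph n p₂ p₃) :=
    (iIndepSet_edgeEvent p₂ p₃).iIndepFun_indicator
  have h := (hind.indepFun_finset S.toFinset T.toFinset (by simpa using hST)
    fun _ => .of_discrete).measure_inter_preimage_eq_mul
      ((fun H (e : S.toFinset) => X e H) '' U) ((fun H (e : T.toFinset) => X e H) '' W)
      .of_discrete .of_discrete
  rw [key S U hU, key T W hW] at h
  simp only [measureReal_def, h, ENNReal.toReal_mul]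

end Independence

/-! ### Exponential bound for the exploration -/

section Exploration

variable {n : ℕ} (p₂ p₃ : I) {P M : Finset (Fin n)} {w : Fin n}

/-- Union bound over the 2-edge `{w, u}` and the 3-edges `{x, w, u}` with `x ∈ P`. -/
lemma measureReal_mem_newlyMarked_le (hPM : P ⊆ M) (hwM : w ∈ M) (hwP : w ∉ P)
    {u : Fin n} (huM : u ∉ M) :
    (randomHypergraph n p₂ p₃).real {H | {u} ⊆ newlyMarked P M w H} ≤ p₂ + P.card * p₃ := by
  have hwu : w ≠ u := fun h => huM (h ▸ hwM)
  have huP : u ∉ P := fun h => huM (hPM h)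
  have hsub : {H : Hypergraph23 (Fin n) | {u} ⊆ newlyMarked P M w H} ⊆
      {H | H.IsEdge {w, u}} ∪ ⋃ x ∈ P, {H | H.IsEdge (insert x {w, u})} := by
    intro H hH
    rw [Set.mem_ofPred_eq, Finset.singleton_subset_iff] at hH
    obtain ⟨-, e, he, heP⟩ := mem_newlyMarked.1 hH
    have hsplit : e = {w, u} ∪ (e ∩ P) := by rw [← heP, Finset.sdiff_union_inter]
    have hcard := Finset.card_sdiff_add_card_inter e P
    rw [heP, Finset.card_pair hwu] at hcard
    rcases he.card_mem with hc | hc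
    · have h0 : e ∩ P = ∅ := Finset.card_eq_zero.1 (by omega)
      rw [h0, Finset.union_empty] at hsplit
      exact .inl (by rwa [← hsplit])
    · obtain ⟨x, hx⟩ := Finset.card_eq_one.1 (by omega : (e ∩ P).card = 1)
      have hxP : x ∈ P := (Finset.mem_inter.1 (hx ▸ Finset.mem_singleton_self x)).2
      rw [hx, Finset.union_comm, ← Finset.insert_eq] at hsplit
      exact .inr (Set.mem_biUnion hxP (by rwa [Set.mem_ofPred_eq, ← hsplit]))
  refine (measureReal_mono hsub).trans ((measureReal_union_le _ _).trans ?_)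
  rw [randomHypergraph_real_isEdge_of_card_two p₂ p₃ (Finset.card_pair hwu)]
  gcongr
  refine (measureReal_biUnion_finset_le _ _).trans (le_of_eq ?_)
  rw [Finset.sum_congr rfl fun x hx => randomHypergraph_real_isEdge_of_card_three p₂ p₃ ?_,
    Finset.sum_const, nsmul_eq_mul]
  have hxw : x ∉ ({w, u} : Finset (Fin n)) := by
    simp only [Finset.mem_insert, Finset.mem_singleton, not_or]
    exact ⟨fun h => hwP (h ▸ hx), fun h => huP (h ▸ hx)⟩
  rw [Finset.card_insert_of_notMem hxw, Finset.card_pair hwu]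

lemma measureReal_subset_newlyMarked_le (hPM : P ⊆ M) (hwM : w ∈ M) (hwP : w ∉ P)
    (A : Finset (Fin n)) (hA : Disjoint A M) :
    (randomHypergraph n p₂ p₃).real {H | A ⊆ newlyMarked P M w H}
      ≤ ((p₂ : ℝ) + P.card * p₃) ^ A.card := by
  have hq : 0 ≤ (p₂ : ℝ) + P.card * p₃ :=
    add_nonneg p₂.2.1 (mul_nonneg (Nat.cast_nonneg _) p₃.2.1)
  induction A using Finset.induction_on with
  | empty => simp
  | insert u A hu ih =>
    rw [Finset.disjoint_insert_left] at hA
    have hset : {H : Hypergraph23 (Fin n) | insert u A ⊆ newlyMarked P M w H}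
        = {H | {u} ⊆ newlyMarked P M w H} ∩ {H | A ⊆ newlyMarked P M w H} := by
      ext H; simp [Finset.insert_subset_iff]
    have hdisj : Disjoint {e : Finset (Fin n) | ∃ a ∈ ({u} : Finset (Fin n)), e \ P = {w, a}}
        {e | ∃ a ∈ A, e \ P = {w, a}} := by
      rw [Set.disjoint_left]
      rintro e ⟨a, ha, he⟩ ⟨b, hb, he'⟩
      rw [Finset.mem_singleton] at ha
      subst ha
      have : a ∈ ({w, b} : Finset (Fin n)) := by rw [← he', he]; simp
      rw [Finset.mem_insert, Finset.mem_singleton] at this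
      rcases this with rfl | rfl
      · exact hA.1 hwM
      · exact hu hb
    rw [hset, (dependsOnEdges_subset_newlyMarked P M {u} w).measureReal_inter p₂ p₃
      (dependsOnEdges_subset_newlyMarked P M A w) hdisj, Finset.card_insert_of_notMem hu, pow_succ']
    exact mul_le_mul (measureReal_mem_newlyMarked_le p₂ p₃ hPM hwM hwP hA.1) (ih hA.2)
      measureReal_nonneg hq

/-- The exponential moment of the number of newly marked vertices. -/
lemma sum_measureReal_newlyMarked_mul_pow_le (hPM : P ⊆ M) (hwM : w ∈ M) (hwP : w ∉ P)
    {c : ℝ} (hc : 0 ≤ c) :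
    ∑ N ∈ Mᶜ.powerset, (randomHypergraph n p₂ p₃).real (newlyMarked P M w ⁻¹' {N})
        * (c + 1) ^ N.card
      ≤ Real.exp (n * ((p₂ : ℝ) + P.card * p₃) * c) := by
  set μ := randomHypergraph n p₂ p₃
  set q : ℝ := (p₂ : ℝ) + P.card * p₃ with hqdef
  have hq : 0 ≤ q := add_nonneg p₂.2.1 (mul_nonneg (Nat.cast_nonneg _) p₃.2.1)
  -- Expanding `(c + 1) ^ |N|` over the subsets `A` of `N` and exchanging sums leaves only the
  -- probabilities that all of `A` is newly marked.
  have hpow : ∀ N ∈ Mᶜ.powerset, μ.real (newlyMarked P M w ⁻¹' {N}) * (c + 1) ^ N.card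
      = ∑ A ∈ Mᶜ.powerset, if A ⊆ N then c ^ A.card * μ.real (newlyMarked P M w ⁻¹' {N})
        else 0 := by
    intro N hN
    rw [Finset.mem_powerset] at hN
    rw [← Finset.sum_filter, ← Finset.sum_pow_mul_eq_add_pow, Finset.mul_sum]
    refine Finset.sum_congr ?_ fun A _ => by rw [one_pow, mul_one, mul_comm]
    ext A
    simp only [Finset.mem_powerset, Finset.mem_filter]
    exact ⟨fun h => ⟨h.trans hN, h⟩, fun h => h.2⟩
  rw [Finset.sum_congr rfl hpow, Finset.sum_comm]
  calc ∑ A ∈ Mᶜ.powerset, ∑ N ∈ Mᶜ.powerset,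
        (if A ⊆ N then c ^ A.card * μ.real (newlyMarked P M w ⁻¹' {N}) else 0)
      ≤ ∑ A ∈ Mᶜ.powerset, c ^ A.card * q ^ A.card := by
        refine Finset.sum_le_sum fun A hA => ?_
        rw [← Finset.sum_filter, ← Finset.mul_sum,
          sum_measureReal_preimage_singleton _ fun _ _ => .of_discrete]
        gcongr
        refine le_trans (measureReal_mono fun H hH => ?_)
          (measureReal_subset_newlyMarked_le p₂ p₃ hPM hwM hwP A
            (Finset.subset_compl_iff_disjoint_right.1 (Finset.mem_powerset.1 hA)))
        have := Set.mem_preimage.1 hH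
        rw [Finset.mem_coe, Finset.mem_filter] at this
        exact this.2
    _ = (c * q + 1) ^ Mᶜ.card := by
        rw [← Finset.sum_pow_mul_eq_add_pow]
        simp [mul_pow]
    _ ≤ Real.exp (c * q) ^ Mᶜ.card := by
        gcongr
        exact Real.add_one_le_exp _
    _ ≤ Real.exp (n * q * c) := by
        rw [← Real.exp_nat_mul, Real.exp_le_exp]
        have : (Mᶜ.card : ℝ) ≤ n := by
          exact_mod_cast (Finset.card_le_univ _).trans_eq (Fintype.card_fin n)
        nlinarith [mul_nonneg hc hq]

/-- Processing one vertex. -/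
lemma measureReal_reachEvent_le_sum (k : ℕ) (hPM : P ⊆ M) (hwM : w ∈ M) (hwP : w ∉ P) :
    (randomHypergraph n p₂ p₃).real (reachEvent k P M)
      ≤ ∑ N ∈ Mᶜ.powerset, (randomHypergraph n p₂ p₃).real (newlyMarked P M w ⁻¹' {N})
        * (randomHypergraph n p₂ p₃).real (reachEvent k (insert w P) (M ∪ N)) := by
  have hsub : reachEvent k P M ⊆ ⋃ N ∈ Mᶜ.powerset,
      (newlyMarked P M w ⁻¹' {N} ∩ reachEvent k (insert w P) (M ∪ N)) := by
    intro H hH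
    refine Set.mem_biUnion (x := newlyMarked P M w H) ?_
      ⟨rfl, mem_reachEvent_process hPM hwM hwP hH⟩
    rw [Finset.mem_coe, Finset.mem_powerset]
    intro u hu
    exact Finset.mem_compl.2 (mem_newlyMarked.1 hu).1
  refine (measureReal_mono hsub (measure_ne_top _ _)).trans
    ((measureReal_biUnion_finset_le _ _).trans_eq ?_)
  refine Finset.sum_congr rfl fun N _ => ?_
  exact (dependsOnEdges_newlyMarked_eq P M N w).measureReal_inter p₂ p₃
    (dependsOnEdges_reachEvent k _ _) (disjoint_process P w)

/-- The exponential bound with tilts `θ s`, by backward induction on the number of processed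
vertices. -/
lemma measureReal_reachEvent_le_exp {m : ℕ} {θ : ℕ → ℝ} (hθ : ∀ s ≤ m, 0 ≤ θ s)
    (hanti : ∀ s < m, θ (s + 1) ≤ θ s) (j : ℕ) :
    ∀ P M : Finset (Fin n), P.card + j = m → P ⊆ M → P.card + 1 ≤ M.card →
      (randomHypergraph n p₂ p₃).real (reachEvent (m + 1) P M)
        ≤ Real.exp (∑ s ∈ Finset.Ico P.card m,
            (n * ((p₂ : ℝ) + s * p₃) * (Real.exp (θ s) - 1) - θ s)
          + θ P.card * ((M.card : ℝ) - P.card - 1)) := by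
  induction j with
  | zero =>
    intro P M hj hPM hM
    refine measureReal_le_one.trans (Real.one_le_exp ?_)
    rw [add_zero] at hj
    rw [hj, Finset.Ico_self, Finset.sum_empty, zero_add]
    rw [hj] at hM
    have : (m : ℝ) + 1 ≤ M.card := by exact_mod_cast hM
    exact mul_nonneg (hθ m le_rfl) (by linarith)
  | succ j ih =>
    intro P M hj hPM hM
    obtain ⟨w, hwM, hwP⟩ := Finset.exists_mem_notMem_of_card_lt_card (by omega : P.card < M.card)
    have hP' : (insert w P).card = P.card + 1 := Finset.card_insert_of_notMem hwP
    set t := P.card with ht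
    set μ := randomHypergraph n p₂ p₃
    set g : ℕ → ℝ := fun s => n * ((p₂ : ℝ) + s * p₃) * (Real.exp (θ s) - 1) - θ s with hg
    set G := ∑ s ∈ Finset.Ico (t + 1) m, g s
    have htm : t < m := by omega
    have hstep : ∀ N ∈ Mᶜ.powerset, μ.real (reachEvent (m + 1) (insert w P) (M ∪ N))
        ≤ Real.exp (G + θ t * ((M.card : ℝ) - t - 1) - θ t) * (Real.exp (θ t) - 1 + 1) ^ N.card := by
      intro N hN
      have hdisj : Disjoint M N :=
        (Finset.subset_compl_iff_disjoint_left.1 (Finset.mem_powerset.1 hN))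
      have hMN : (M ∪ N).card = M.card + N.card := Finset.card_union_of_disjoint hdisj
      have hsub : insert w P ⊆ M ∪ N :=
        (Finset.insert_subset hwM hPM).trans Finset.subset_union_left
      by_cases hcard : t + 2 ≤ (M ∪ N).card
      · refine (ih (insert w P) (M ∪ N) (by omega) hsub (by omega)).trans ?_
        rw [sub_add_cancel, ← Real.exp_nat_mul, ← Real.exp_add, Real.exp_le_exp, hP', hMN]
        have h2 : ((t + 2 : ℕ) : ℝ) ≤ ((M.card + N.card : ℕ) : ℝ) := by
          exact_mod_cast hMN ▸ hcard
        push_cast at h2 ⊢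
        -- The surplus of marked over processed vertices is nonnegative here, so replacing `θ (t +
        -- 1)` by `θ t` only increases the bound.
        have := mul_le_mul_of_nonneg_right (hanti t htm)
          (by linarith : (0 : ℝ) ≤ M.card + N.card - (t + 1) - 1)
        linarith
      -- No unprocessed marked vertex remains, so `m + 1` vertices are never reached.
      · have heq : insert w P = M ∪ N := Finset.eq_of_subset_of_card_le hsub (by omega)
        rw [← heq, reachEvent_self (by omega), measureReal_empty]
        rw [sub_add_cancel]
        positivity
    calc μ.real (reachEvent (m + 1) P M)
        ≤ ∑ N ∈ Mᶜ.powerset, μ.real (newlyMarked P M w ⁻¹' {N})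
            * μ.real (reachEvent (m + 1) (insert w P) (M ∪ N)) :=
          measureReal_reachEvent_le_sum p₂ p₃ _ hPM hwM hwP
      _ ≤ ∑ N ∈ Mᶜ.powerset, μ.real (newlyMarked P M w ⁻¹' {N})
            * (Real.exp (G + θ t * ((M.card : ℝ) - t - 1) - θ t)
              * (Real.exp (θ t) - 1 + 1) ^ N.card) := by
          gcongr with N hN
          exact hstep N hN
      _ = Real.exp (G + θ t * ((M.card : ℝ) - t - 1) - θ t)
            * ∑ N ∈ Mᶜ.powerset, μ.real (newlyMarked P M w ⁻¹' {N})
              * (Real.exp (θ t) - 1 + 1) ^ N.card := by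
          rw [Finset.mul_sum]
          exact Finset.sum_congr rfl fun N _ => by ring
      _ ≤ Real.exp (G + θ t * ((M.card : ℝ) - t - 1) - θ t)
            * Real.exp (n * ((p₂ : ℝ) + t * p₃) * (Real.exp (θ t) - 1)) := by
          gcongr
          exact sum_measureReal_newlyMarked_mul_pow_le p₂ p₃ hPM hwM hwP
            (by linarith [Real.one_le_exp (hθ t htm.le)])
      _ = Real.exp (∑ s ∈ Finset.Ico t m, g s + θ t * ((M.card : ℝ) - t - 1)) := by
          rw [← Real.exp_add, Finset.sum_eq_sum_Ico_succ_bot htm]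
          congr 1
          simp only [hg, G]
          ring

lemma measureReal_component_le_exp {m : ℕ} {θ : ℕ → ℝ} (hθ : ∀ s ≤ m, 0 ≤ θ s)
    (hanti : ∀ s < m, θ (s + 1) ≤ θ s) (v₀ : Fin n) :
    (randomHypergraph n p₂ p₃).real {H | m + 1 ≤ (component H v₀).ncard}
      ≤ Real.exp (∑ s ∈ Finset.range m,
          (n * ((p₂ : ℝ) + s * p₃) * (Real.exp (θ s) - 1) - θ s)) := by
  have hsub : {H : Hypergraph23 (Fin n) | m + 1 ≤ (component H v₀).ncard}
      ⊆ reachEvent (m + 1) ∅ {v₀} := fun H hH => mem_reachEvent_of_le_component hH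
  refine (measureReal_mono hsub).trans ?_
  have h := measureReal_reachEvent_le_exp p₂ p₃ hθ hanti m ∅ {v₀} (by simp) (by simp) (by simp)
  rw [Finset.card_empty, Finset.card_singleton, ← Finset.range_eq_Ico] at h
  simpa only [Nat.cast_one, Nat.cast_zero, sub_zero, sub_self, mul_zero, add_zero] using h

end Exploration

end PropConn
namespace PropConn

/-! ### The rate function and its Riemann sums -/

open MeasureTheory

/-- The integrand of `rateI`. -/
noncomputable def rateFun (ε r x : ℝ) : ℝ := 1 - lam ε r x + Real.log (lam ε r x)

variable {ε r : ℝ}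

lemma lam_pos (hε₁ : ε < 1) (hr : 0 < r) {x : ℝ} (hx : 0 ≤ x) : 0 < lam ε r x := by
  have := mul_nonneg hr.le hx
  unfold lam; linarith

lemma lam_le_one (hr : 0 < r) {x : ℝ} (hx : x ≤ ε / r) : lam ε r x ≤ 1 := by
  rw [le_div_iff₀ hr] at hx
  unfold lam; linarith

lemma lam_mono (hr : 0 < r) : Monotone (lam ε r) := fun x y h => by
  unfold lam; gcongr

lemma rateFun_nonpos (hε₁ : ε < 1) (hr : 0 < r) {x : ℝ} (hx : 0 ≤ x) : rateFun ε r x ≤ 0 := by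
  have := Real.log_le_sub_one_of_pos (lam_pos hε₁ hr hx)
  unfold rateFun; linarith

/-- `ln y - y` increases on `(0, 1]`, and `λ` is increasing with values there. -/
lemma rateFun_monotoneOn (hε₁ : ε < 1) (hr : 0 < r) :
    MonotoneOn (rateFun ε r) (Set.Icc 0 (ε / r)) := by
  intro x hx y hy hxy
  have hx0 := lam_pos hε₁ hr hx.1
  have hy0 := lam_pos hε₁ hr hy.1
  have hy1 := lam_le_one hr hy.2
  have hxy' := lam_mono (ε := ε) hr hxy
  have h := Real.log_le_sub_one_of_pos (div_pos hx0 hy0)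
  rw [Real.log_div hx0.ne' hy0.ne'] at h
  have h2 : lam ε r x / lam ε r y - 1 ≤ lam ε r x - lam ε r y := by
    rw [div_sub_one hy0.ne', div_le_iff₀ hy0]
    nlinarith
  unfold rateFun
  linarith

lemma rateFun_intervalIntegrable (hε₁ : ε < 1) (hr : 0 < r) {a b : ℝ} (ha : 0 ≤ a) (hab : a ≤ b)
    (hb : b ≤ ε / r) : IntervalIntegrable (rateFun ε r) volume a b := by
  apply MonotoneOn.intervalIntegrable
  rw [Set.uIcc_of_le hab]
  exact (rateFun_monotoneOn hε₁ hr).mono (Set.Icc_subset_Icc ha hb)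

/-- The Riemann sum of the rate function is at most the integral up to a constant. -/
lemma sum_rateFun_le (hε₀ : 0 < ε) (hε₁ : ε < 1) (hr : 0 < r) {L : ℝ} (hL : 0 < L) :
    ∑ s ∈ Finset.range ⌊ε / r * L⌋₊, rateFun ε r (s / L) ≤ L * rateI ε r - rateFun ε r 0 := by
  have hT : 0 < ε / r := div_pos hε₀ hr
  set m := ⌊ε / r * L⌋₊ with hm
  have hmT : (m : ℝ) / L ≤ ε / r := by
    rw [div_le_iff₀ hL]
    exact Nat.floor_le (by positivity)
  have hmT' : ε / r - m / L ≤ 1 / L := by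
    rw [sub_le_iff_le_add, ← add_div, le_div_iff₀ hL, add_comm]
    exact (Nat.lt_floor_add_one _).le
  have hm0 : 0 ≤ (m : ℝ) / L := by positivity
  have hmono : MonotoneOn (fun x => rateFun ε r (x / L)) (Set.Icc 0 (0 + (m : ℝ))) := by
    intro x hx y hy hxy
    rw [zero_add] at hx hy
    refine rateFun_monotoneOn hε₁ hr ⟨div_nonneg hx.1 hL.le, ?_⟩ ⟨div_nonneg hy.1 hL.le, ?_⟩ ?_
    · exact (div_le_div_of_nonneg_right hx.2 hL.le).trans hmT
    · exact (div_le_div_of_nonneg_right hy.2 hL.le).trans hmT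
    · exact div_le_div_of_nonneg_right hxy hL.le
  have h1 := hmono.sum_le_integral
  simp only [zero_add] at h1
  rw [intervalIntegral.integral_comp_div _ hL.ne', zero_div, smul_eq_mul] at h1
  have hsplit : rateI ε r = (∫ x in (0 : ℝ)..(m / L), rateFun ε r x)
      + ∫ x in (m / L)..(ε / r), rateFun ε r x :=
    (intervalIntegral.integral_add_adjacent_intervals
      (rateFun_intervalIntegrable hε₁ hr le_rfl hm0 hmT)
      (rateFun_intervalIntegrable hε₁ hr hm0 hmT le_rfl)).symm
  have h0 := rateFun_nonpos hε₁ hr (le_refl (0 : ℝ))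
  -- The floor leaves an interval of length at most `1 / L`, on which the integrand is at least its
  -- value at `0`; after scaling by `L` this costs a constant.
  have h2 : (ε / r - m / L) * rateFun ε r 0 ≤ ∫ x in (m / L)..(ε / r), rateFun ε r x := by
    have := intervalIntegral.integral_mono_on hmT
      (intervalIntegrable_const (c := rateFun ε r 0))
      (rateFun_intervalIntegrable hε₁ hr hm0 hmT le_rfl)
      fun x hx => rateFun_monotoneOn hε₁ hr ⟨le_rfl, hT.le⟩ ⟨hm0.trans hx.1, hx.2⟩ (hm0.trans hx.1)
    simpa using this
  have h3 : 1 / L * rateFun ε r 0 ≤ ∫ x in (m / L)..(ε / r), rateFun ε r x :=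
    (mul_le_mul_of_nonpos_right hmT' h0).trans h2
  have h4 := mul_le_mul_of_nonneg_left h3 hL.le
  rw [← mul_assoc, mul_one_div_cancel hL.ne', one_mul] at h4
  rw [hsplit, mul_add]
  linarith

lemma div_lt_K₀ (hε₀ : 0 < ε) (hr : 0 < r) : ε / r < K₀ ε r := by
  refine lt_of_lt_of_le ?_ (le_max_right _ _)
  unfold lam₁InvTen
  gcongr
  linarith

end PropConn

theorem mainTheorem3 (ε r : ℝ) (hε₀ : 0 < ε) (hε₁ : ε < 1) (hr : 0 < r) :
    ∃ δ : ℕ → ℝ, Filter.Tendsto δ Filter.atTop (nhds 0) ∧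
      ∀ n : ℕ, 2 ≤ n → ∀ p₂ p₃ : unitInterval,
        (p₂ : ℝ) = (1 - ε) / n → (p₃ : ℝ) = r / (n * Real.log n) →
        ∀ v₀ : Fin n,
          (PropConn.randomHypergraph n p₂ p₃).real
            {H | PropConn.K₀ ε r * Real.log n ≤ ((PropConn.component H v₀).ncard : ℝ)}
          ≤ (n : ℝ) ^ (PropConn.rateI ε r + δ n) := by
  -- Since `n ^ (c / ln n) = exp c`, this `δ` absorbs exactly the constant error of the Riemann sum.
  refine ⟨fun n => -PropConn.rateFun ε r 0 / Real.log n,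
    Filter.Tendsto.const_div_atTop
      (Real.tendsto_log_atTop.comp tendsto_natCast_atTop_atTop) _, ?_⟩
  intro n hn p₂ p₃ hp₂ hp₃ v₀
  have hn1 : (1 : ℝ) < n := by exact_mod_cast hn
  have hL : 0 < Real.log n := Real.log_pos hn1
  set L := Real.log n with hLdef
  set m := ⌊ε / r * L⌋₊ with hm
  have hT : 0 < ε / r := div_pos hε₀ hr
  have hmT : (m : ℝ) ≤ ε / r * L := Nat.floor_le (by positivity)
  have hdom : ∀ s ≤ m, (s : ℝ) / L ≤ ε / r := fun s hs => by
    rw [div_le_iff₀ hL]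
    exact le_trans (by exact_mod_cast hs) hmT
  have hpos : ∀ s : ℕ, 0 < PropConn.lam ε r (s / L) := fun s =>
    PropConn.lam_pos hε₁ hr (by positivity)
  -- The tilt `-ln λ` minimises `λ (exp θ - 1) - θ`. It is nonnegative as long as `λ ≤ 1`, which is
  -- why `m` stops at `ε / r * L`.
  have hbound := PropConn.measureReal_component_le_exp p₂ p₃ (m := m)
    (θ := fun s => -Real.log (PropConn.lam ε r (s / L)))
    (fun s hs => neg_nonneg.2
      (Real.log_nonpos (hpos s).le (PropConn.lam_le_one hr (hdom s hs))))
    (fun s _ => neg_le_neg (Real.log_le_log (hpos s)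
      (PropConn.lam_mono hr (by gcongr; simp)))) v₀
  have hsub : {H | PropConn.K₀ ε r * L ≤ ((PropConn.component H v₀).ncard : ℝ)}
      ⊆ {H | m + 1 ≤ (PropConn.component H v₀).ncard} := by
    intro H hH
    rw [Set.mem_ofPred_eq] at hH ⊢
    -- `K₀` enters only through `ε / r < K₀`.
    have h := mul_lt_mul_of_pos_right (PropConn.div_lt_K₀ hε₀ hr) hL
    have : (m : ℝ) < (PropConn.component H v₀).ncard := by linarith
    exact_mod_cast this
  refine (MeasureTheory.measureReal_mono hsub).trans (hbound.trans ?_)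
  rw [Real.rpow_def_of_pos (by linarith), Real.exp_le_exp, mul_add, ← hLdef,
    mul_div_cancel₀ _ hL.ne', ← sub_eq_add_neg]
  refine le_trans (le_of_eq ?_) (PropConn.sum_rateFun_le hε₀ hε₁ hr hL)
  refine Finset.sum_congr rfl fun s _ => ?_
  have hlam : n * ((p₂ : ℝ) + s * p₃) = PropConn.lam ε r (s / L) := by
    rw [hp₂, hp₃, PropConn.lam]
    field_simp
  rw [hlam, Real.exp_neg, Real.exp_log (hpos s), mul_sub, mul_inv_cancel₀ (hpos s).ne',
    PropConn.rateFun]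
  ring
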